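/- Let $\mathbb T=\mathbb R/\mathbb Z$ with the periodic distance $d$ and the uniform probability measure, and let $n\ge 2$, $h>0$, $L>0$ ($h,L$ real). Let $f\colon\mathbb T\to\mathbb R$ be Lipschitz continuous with constant $L$, write $\|f\|_\infty=\sup_{x\in\mathbb T}|f(x)|$, and let $k_h\colon[0,\infty)\to[0,\infty)$ be a measurable function with $\operatorname{supp}k_h=\overline{\{t: k_h(t)\ne0\}}=[0,1/h]$ and $k_h(t)>0$ for $0\le t<1/h$. For a finite family $\boldsymbol z=(x_j,y_j)_j$ of points of $\mathbb T\times\mathbb R$, Shepard's model is $$R_h(\boldsymbol z)(x)=\frac{\sum_j k_h(d(x,x_j))\,y_j}{\sum_j k_h(d(x,x_j))},\qquad x\in\mathbb T,$$ with the convention $R_h(\boldsymbol z)(x)=0$ where the denominator vanishes. For $\boldsymbol z=(x_i,f(x_i))_{i=1}^n$ let $\boldsymbol z_{-i}$ be $\boldsymbol z$ without its $i$-th entry, and put $$\mathcal E(g)=\int_{\mathbb T}|g(x)-f(x)|^2\,\mathrm dx,\qquad \mathrm{CV}(\boldsymbol z,h)=\frac1n\sum_{i=1}^n|R_h(\boldsymbol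 z_{-i})(x_i)-f(x_i)|^2 .$$ Let $X_1,\dots,X_n$ be independent and uniformly distributed on $\mathbb T$, let $\boldsymbol Z=(X_i,f(X_i))_{i=1}^n$, and set $$\gamma=\sum_{k=1}^{\lfloor h\rfloor}(-1)^{k+1}\binom nk\Bigl(1-\frac{k}{2h}\Bigr)^{n-1}.$$ Then for every $\varepsilon>2\gamma\max\{(4n+1)L^2/h^2,\;4\|f\|_\infty^2\}$, $$\mathbb P\bigl\{|\mathrm{CV}(\boldsymbol Z,h)-\mathcal E(R_h(\boldsymbol Z_{-1}))|>\varepsilon\bigr\}\le 2\gamma+2\exp\Bigl(-\Bigl(\frac{h^2\varepsilon}{12\sqrt n\,L^2}-\sqrt{2n}\,\gamma\Bigr)^2\Bigr).$$ Moreover, for every $\delta>0$, with probability larger than $1-2(\gamma+\delta)$, $$|\mathrm{CV}(\boldsymbol Z,h)-\mathcal E(R_h(\boldsymbol Z_{-1}))|\le\max\Bigl\{4\gamma\|f\|_\infty^2,\;\frac{12\sqrt n\,L^2}{h^2}\bigl(\sqrt{2n}\,\gamma+\sqrt{-\log\delta}\bigr)\Bigr\},$$ where $\sqrt{-\log\delta}$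 is read as $0$ for $\delta>1$. -/

import Mathlib

open MeasureTheory ProbabilityTheory
open scoped NNReal

noncomputable section

/-- The radial kernel `K(x, x') = k(d(x, x'))` on the one-dimensional torus `ℝ / ℤ`, where `d` is
the periodic distance and `k : [0, ∞) → [0, ∞)`. -/
def radialKernel (k : ℝ≥0 → ℝ≥0) (x x' : UnitAddCircle) : ℝ :=
  (k (nndist x x') : ℝ)

/-- Shepard's model (Nadaraya-Watson estimator) for the data `z`, a finite family of pairs
(node, value). At points where the denominator vanishes the value is `0`. -/
def shepard {ι : Type*} [Fintype ι] (k : ℝ≥0 → ℝ≥0) (z : ι → UnitAddCircle × ℝ)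
    (x : UnitAddCircle) : ℝ :=
  (∑ j, radialKernel k x (z j).1 * (z j).2) / ∑ j, radialKernel k x (z j).1

/-- The sample `z` with its `i`-th data point removed. -/
def leaveOut {n : ℕ} (z : Fin n → UnitAddCircle × ℝ) (i : Fin n) :
    {j : Fin n // j ≠ i} → UnitAddCircle × ℝ :=
  fun j => z j

/-- The risk functional of the reconstruction `g` of `f`: squared loss with respect to the uniform
probability measure on the torus. -/
def risk (f g : UnitAddCircle → ℝ) : ℝ :=
  ∫ x : UnitAddCircle, |g x - f x| ^ 2

/-- The leave-one-out cross-validation score of Shepard's model. -/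
def cvScore {n : ℕ} (k : ℝ≥0 → ℝ≥0) (f : UnitAddCircle → ℝ)
    (z : Fin n → UnitAddCircle × ℝ) : ℝ :=
  (1 / (n : ℝ)) * ∑ i, |shepard k (leaveOut z i) (z i).1 - f (z i).1| ^ 2

/-- The uniform norm of a (bounded) function on the torus. -/
def uniformNorm (f : UnitAddCircle → ℝ) : ℝ :=
  ⨆ x, |f x|

/-- The alternating sum `∑_{k=1}^{⌊h⌋} (-1)^{k+1} (n choose k) (1 - k/(2h))^{n-1}`. -/
def failBound (n : ℕ) (h : ℝ) : ℝ :=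
  ∑ k ∈ Finset.Icc 1 ⌊h⌋₊, (-1 : ℝ) ^ (k + 1) * (n.choose k : ℝ) * (1 - k / (2 * h)) ^ (n - 1)

end

/-! No concentration inequality is needed. Put C = L²/h². If every node is followed on the circle by
another node within distance less than 1/h, then removing one node leaves gaps shorter than 2/h.
Every point is then closer than 1/h to a remaining node, all leave-one-out errors are at most L/h,
and both the score and the risk lie in [0, C]. A union bound gives probability at most p = n(1 -
1/h)^(n-1) for failure. In every case both quantities lie in [0, max(C, ‖f‖²)].

The core is `failBound_bounds`: p ≤ 2γ whenever γ < 1/4. For γ ≥ 1/4 the deterministic bound settles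
both claims. For ε < C the exponential term already exceeds 1, and for ε ≥ C the term 2γ suffices.
In the second claim the right-hand side is at least C unless γ + δ > 1/2, where nothing is to be
shown.

With a = 1/(2h), γ is an inclusion-exclusion sum for the event that some spacing exceeds a,
truncated at ⌊h⌋ although nonzero terms may occur up to 2h. Its terms are binomial moments S_k of
weights on {0, …, n}, nonnegative because they are differences of truncated powers. Averaging a
pointwise Bonferroni inequality against these weights gives γ ≥ s/(1+s) with s = S_1 when ⌊h⌋ is
odd, and the same minus S_(⌊h⌋+1) when it is even. The even case is closed by numerical estimates
together with p ≤ s and pn ≤ s². -/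

/-! ### Differences of truncated powers -/

/-- The `N`-th backward difference, with step `a`, of the truncated power `x ↦ x₊ ^ p`. -/
def truncPowDiff (a : ℝ) (N p : ℕ) (x : ℝ) : ℝ :=
  ∑ k ∈ Finset.range (N + 1), (-1 : ℝ) ^ k * (N.choose k : ℝ) * (max (x - k * a) 0) ^ p

theorem truncPowDiff_succ (a : ℝ) (N p : ℕ) (x : ℝ) :
    truncPowDiff a (N + 1) p x = truncPowDiff a N p x - truncPowDiff a N p (x - a) := by
  unfold truncPowDiff
  have h0 : ∑ k ∈ Finset.range (N + 1), (-1 : ℝ) ^ k * (N.choose k : ℝ) * (max (x - k * a) 0) ^ p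
      = ∑ k ∈ Finset.range (N + 2),
          (-1 : ℝ) ^ k * (N.choose k : ℝ) * (max (x - k * a) 0) ^ p := by
    rw [Finset.sum_range_succ _ (N + 1)]
    simp
  rw [h0, Finset.sum_range_succ' _ (N + 1), Finset.sum_range_succ' _ (N + 1), add_sub_right_comm,
    ← Finset.sum_sub_distrib]
  congr 1
  · refine Finset.sum_congr rfl fun k _ => ?_
    rw [Nat.choose_succ_succ, show x - a - k * a = x - (k + 1 : ℕ) * a by push_cast; ring]
    push_cast
    ring
  · simp

theorem hasDerivAt_max_zero_pow (p : ℕ) (x : ℝ) :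
    HasDerivAt (fun y : ℝ => (max y 0) ^ (p + 2)) ((p + 2) * (max x 0) ^ (p + 1)) x := by
  rcases lt_trichotomy x 0 with hx | hx | hx
  · rw [max_eq_right hx.le]
    have : (fun y : ℝ => (max y 0) ^ (p + 2)) =ᶠ[nhds x] fun _ => 0 := by
      filter_upwards [eventually_lt_nhds hx] with y hy
      simp [max_eq_right hy.le]
    simpa using (hasDerivAt_const x (0 : ℝ)).congr_of_eventuallyEq this
  · subst hx
    have hl : HasDerivWithinAt (fun y : ℝ => (max y 0) ^ (p + 2)) 0 (Set.Iic 0) 0 :=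
      (hasDerivWithinAt_const (0 : ℝ) (Set.Iic 0) (0 : ℝ)).congr
        (fun y hy => by simp [max_eq_right (Set.mem_Iic.1 hy)]) (by simp)
    have hr : HasDerivWithinAt (fun y : ℝ => (max y 0) ^ (p + 2)) 0 (Set.Ici 0) 0 := by
      have := (hasDerivAt_pow (p + 2) (0 : ℝ)).hasDerivWithinAt (s := Set.Ici 0)
      refine (this.congr (fun y hy => by simp [max_eq_left (Set.mem_Ici.1 hy)]) (by simp)).congr_deriv
        (by simp)
    have := hl.union hr
    rw [Set.Iic_union_Ici, hasDerivWithinAt_univ] at this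
    simpa using this
  · rw [max_eq_left hx.le]
    have : (fun y : ℝ => (max y 0) ^ (p + 2)) =ᶠ[nhds x] fun y => y ^ (p + 2) := by
      filter_upwards [eventually_gt_nhds hx] with y hy
      simp [max_eq_left hy.le]
    have h2 := (hasDerivAt_pow (p + 2) x).congr_of_eventuallyEq this
    simpa using h2

theorem hasDerivAt_truncPowDiff (a : ℝ) (N p : ℕ) (x : ℝ) :
    HasDerivAt (truncPowDiff a N (p + 2)) ((p + 2) * truncPowDiff a N (p + 1) x) x := by
  unfold truncPowDiff
  rw [Finset.mul_sum]
  refine HasDerivAt.fun_sum fun k _ => ?_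
  have h := (hasDerivAt_max_zero_pow p (x - k * a)).comp x ((hasDerivAt_id x).sub_const (k * a))
  refine (h.const_mul ((-1 : ℝ) ^ k * (N.choose k : ℝ))).congr_deriv ?_
  simp only [mul_one]
  ring

/-- Differentiation lowers the power and keeps the difference order, so nonnegativity for one power
makes the differences of the next power monotone, and one more backward difference is then
nonnegative. The base case, with order up to two, is monotonicity and convexity of the positive
part. -/
theorem truncPowDiff_nonneg {a : ℝ} (ha : 0 ≤ a) (p : ℕ) :
    ∀ N ≤ p + 2, ∀ x, 0 ≤ truncPowDiff a N (p + 1) x := by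
  induction p with
  | zero =>
    intro N hN x
    interval_cases N
    · simp [truncPowDiff]
    · simp only [truncPowDiff, Finset.sum_range_succ, Finset.sum_range_zero]
      have : max (x - a) 0 ≤ max x 0 := max_le_max (by linarith) le_rfl
      simp; simpa using this
    · simp only [truncPowDiff, Finset.sum_range_succ, Finset.sum_range_zero]
      simp only [zero_add, pow_zero, pow_one, Nat.choose_zero_right, Nat.choose_one_right,
        Nat.choose_self]
      push_cast
      rcases max_cases (x - 0 * a) 0 with h | h <;> rcases max_cases (x - 1 * a) 0 with h' | h' <;>
        rcases max_cases (x - 2 * a) 0 with h'' | h'' <;> rw [h.1, h'.1, h''.1] <;> nlinarith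
  | succ p ih =>
    intro N hN x
    cases N with
    | zero => simp only [truncPowDiff, zero_add, Finset.sum_range_one]; simp
    | succ N =>
      have hmono : Monotone (truncPowDiff a N (p + 2)) := by
        refine monotone_of_deriv_nonneg
          (fun y => (hasDerivAt_truncPowDiff a N p y).differentiableAt) fun y => ?_
        rw [(hasDerivAt_truncPowDiff a N p y).deriv]
        exact mul_nonneg (by positivity) (ih N (by omega) y)
      rw [truncPowDiff_succ]
      exact sub_nonneg.2 (hmono (by linarith))

/-! ### Spacing weights and their binomial moments -/

/-- The probability that exactly `j` of the `n` spacings of `n` uniform points on a circle of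
length one exceed `a`. -/
def spacingWeight (n : ℕ) (a : ℝ) (j : ℕ) : ℝ :=
  (n.choose j : ℝ) * truncPowDiff a (n - j) (n - 1) (1 - j * a)

theorem spacingWeight_nonneg {n : ℕ} (hn : 2 ≤ n) {a : ℝ} (ha : 0 ≤ a) (j : ℕ) :
    0 ≤ spacingWeight n a j := by
  obtain ⟨p, rfl⟩ := Nat.exists_eq_add_of_le' hn
  exact mul_nonneg (by positivity) (truncPowDiff_nonneg ha p _ (by omega) _)

/-- The `k`-th binomial moment of the number of spacings exceeding `a`. -/
def spacingMoment (n : ℕ) (a : ℝ) (k : ℕ) : ℝ :=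
  (n.choose k : ℝ) * (max (1 - k * a) 0) ^ (n - 1)

theorem spacingMoment_nonneg (n : ℕ) (a : ℝ) (k : ℕ) : 0 ≤ spacingMoment n a k := by
  unfold spacingMoment; positivity

theorem spacingWeight_eq_sum {n : ℕ} {a : ℝ} {j : ℕ} (hj : j ≤ n) :
    spacingWeight n a j = ∑ i ∈ Finset.range (n + 1),
      (-1 : ℝ) ^ (i - j) * (i.choose j : ℝ) * spacingMoment n a i := by
  have hsplit : n + 1 = j + (n - j + 1) := by omega
  rw [hsplit, Finset.sum_range_add, Finset.sum_eq_zero, zero_add]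
  · unfold spacingWeight truncPowDiff
    rw [Finset.mul_sum]
    refine Finset.sum_congr rfl fun i hi => ?_
    have hi' : j + i ≤ n := by have := Finset.mem_range.1 hi; omega
    have hc : (n.choose j : ℝ) * ((n - j).choose i : ℝ)
        = (n.choose (j + i) : ℝ) * ((j + i).choose j : ℝ) := by
      have := Nat.choose_mul (n := n) (Nat.le_add_right j i)
      rw [Nat.add_sub_cancel_left] at this
      exact_mod_cast this.symm
    unfold spacingMoment
    rw [Nat.add_sub_cancel_left,
      show (1 : ℝ) - j * a - i * a = 1 - ((j + i : ℕ) : ℝ) * a by push_cast; ring]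
    linear_combination ((-1 : ℝ) ^ i * (max (1 - ((j + i : ℕ) : ℝ) * a) 0) ^ (n - 1)) * hc
  · intro i hi
    -- For i < j the truncated exponent `i - j` is harmless, since the binomial coefficient
    -- vanishes.
    simp [Nat.choose_eq_zero_of_lt (Finset.mem_range.1 hi)]

/-- Binomial inversion: the sum is the `i`-th forward difference at 0 of the function j ↦ C(j, k).
-/
theorem sum_alternating_choose_mul_choose {n i k : ℕ} (hi : i ≤ n) :
    ∑ j ∈ Finset.range (n + 1), (-1 : ℝ) ^ (i - j) * (i.choose j : ℝ) * (j.choose k : ℝ)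
      = if i = k then 1 else 0 := by
  have h := fwdDiff_iter_choose_zero k i
  rw [fwdDiff_iter_eq_sum_shift] at h
  have h' := congrArg (Int.cast : ℤ → ℝ) h
  push_cast at h'
  simp only [zero_add, smul_eq_mul, mul_one, Int.cast_mul, Int.cast_pow, Int.cast_neg, Int.cast_one,
    Int.cast_natCast] at h'
  rw [← h']
  refine (Finset.sum_subset (Finset.range_mono (by omega)) fun j _ hj => ?_).symm
  rw [Finset.mem_range, not_lt] at hj
  simp [Nat.choose_eq_zero_of_lt (show i < j by omega)]

/-- This transfers inequalities between binomial coefficients, valid for every j, to inequalities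
between moments. Only this identity and nonnegativity of the weights are used, not their
probabilistic meaning. -/
theorem sum_spacingWeight_mul_choose (n : ℕ) (a : ℝ) (k : ℕ) :
    ∑ j ∈ Finset.range (n + 1), spacingWeight n a j * (j.choose k : ℝ) = spacingMoment n a k := by
  have h1 : ∀ j ∈ Finset.range (n + 1), spacingWeight n a j * (j.choose k : ℝ)
      = ∑ i ∈ Finset.range (n + 1), spacingMoment n a i *
        ((-1 : ℝ) ^ (i - j) * (i.choose j : ℝ) * (j.choose k : ℝ)) := by
    intro j hj
    rw [spacingWeight_eq_sum (Nat.lt_succ_iff.1 (Finset.mem_range.1 hj)), Finset.sum_mul]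
    exact Finset.sum_congr rfl fun i _ => by ring
  rw [Finset.sum_congr rfl h1, Finset.sum_comm]
  simp_rw [← Finset.mul_sum]
  rw [Finset.sum_congr rfl fun i hi => by
    rw [sum_alternating_choose_mul_choose (k := k) (Nat.lt_succ_iff.1 (Finset.mem_range.1 hi))]]
  simp only [mul_ite, mul_one, mul_zero, Finset.sum_ite_eq', Finset.mem_range]
  split_ifs with hk
  · rfl
  · simp [spacingMoment, Nat.choose_eq_zero_of_lt (show n < k by omega)]

/-! ### Bonferroni inequalities -/

/-- A Bonferroni-type lower bound for truncated alternating sums of binomial coefficients. -/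
theorem le_alternating_sum_choose (m j : ℕ) (t : ℝ) :
    (2 * t - t ^ 2) * j - 2 * t ^ 2 * (j.choose 2 : ℝ)
        - (if Even m then (j.choose (m + 1) : ℝ) else 0)
      ≤ ∑ k ∈ Finset.Icc 1 m, (-1 : ℝ) ^ (k + 1) * (j.choose k : ℝ) := by
  cases j with
  | zero =>
    rw [Finset.sum_eq_zero]
    · simp
    · intro k hk
      have : k ≠ 0 := by have := (Finset.mem_Icc.1 hk).1; omega
      simp [Nat.choose_eq_zero_of_lt (Nat.pos_of_ne_zero this)]
  | succ j =>
    have hsum : ∑ k ∈ Finset.Icc 1 m, (-1 : ℝ) ^ (k + 1) * ((j + 1).choose k : ℝ)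
        = 1 - (-1) ^ m * (j.choose m : ℝ) := by
      have h := congrArg (Int.cast : ℤ → ℝ) (Int.alternating_sum_range_choose_eq_choose (n := j)
        (m := m))
      push_cast at h
      rw [Finset.range_eq_Ico, Finset.sum_eq_sum_Ico_succ_bot (Nat.succ_pos m)] at h
      have hI : Finset.Ico (0 + 1) (m + 1) = Finset.Icc 1 m := by ext; simp
      rw [hI] at h
      simp only [pow_zero, Nat.choose_zero_right, Nat.cast_one, mul_one] at h
      rw [← h]
      simp [pow_succ]
    rw [hsum, Nat.cast_choose_two]
    -- Since j² = j + 2 C(j, 2), the `t`-terms of the bound equal 2tj - t²j², which is at most 1 by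
    -- this square.
    have hsq := sq_nonneg (1 - t * ((j + 1 : ℕ) : ℝ))
    have hpos : (0 : ℝ) ≤ (j.choose m : ℝ) := by positivity
    split_ifs with hm
    · rw [hm.neg_one_pow, Nat.choose_succ_succ]
      have : (0 : ℝ) ≤ (j.choose (m + 1) : ℝ) := by positivity
      push_cast at *
      nlinarith
    · rw [(Nat.not_even_iff_odd.1 hm).neg_one_pow]
      nlinarith

theorem spacingMoment_two_le {n : ℕ} (hn : 1 ≤ n) {a : ℝ} (ha : a ≤ 1) :
    2 * spacingMoment n a 2 ≤ spacingMoment n a 1 ^ 2 := by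
  unfold spacingMoment
  rw [Nat.cast_choose_two, Nat.choose_one_right]
  have h1 : max (1 - ((2 : ℕ) : ℝ) * a) 0 ≤ (max (1 - ((1 : ℕ) : ℝ) * a) 0) ^ 2 := by
    rw [max_eq_left (show (0 : ℝ) ≤ 1 - ((1 : ℕ) : ℝ) * a by push_cast; linarith)]
    refine max_le ?_ (sq_nonneg _)
    push_cast
    nlinarith [sq_nonneg a]
  have h2 := pow_le_pow_left₀ (le_max_right _ _) h1 (n - 1)
  have hn' : (1 : ℝ) ≤ n := by exact_mod_cast hn
  have h3 : (0 : ℝ) ≤ max (1 - ((2 : ℕ) : ℝ) * a) 0 ^ (n - 1) := by positivity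
  calc 2 * ((n : ℝ) * (n - 1) / 2 * max (1 - ((2 : ℕ) : ℝ) * a) 0 ^ (n - 1))
      = (n : ℝ) * (n - 1) * max (1 - ((2 : ℕ) : ℝ) * a) 0 ^ (n - 1) := by ring
    _ ≤ (n : ℝ) * n * max (1 - ((2 : ℕ) : ℝ) * a) 0 ^ (n - 1) := by gcongr; linarith
    _ ≤ (n : ℝ) * n * (max (1 - ((1 : ℕ) : ℝ) * a) 0 ^ 2) ^ (n - 1) := by gcongr
    _ = _ := by ring

theorem le_alternating_sum_spacingMoment {n : ℕ} (hn : 2 ≤ n) {a : ℝ} (ha : 0 ≤ a) (ha1 : a ≤ 1)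
    (m : ℕ) :
    spacingMoment n a 1 / (1 + spacingMoment n a 1)
        - (if Even m then spacingMoment n a (m + 1) else 0)
      ≤ ∑ k ∈ Finset.Icc 1 m, (-1 : ℝ) ^ (k + 1) * spacingMoment n a k := by
  set s := spacingMoment n a 1 with hs
  have hs0 : 0 ≤ s := spacingMoment_nonneg _ _ _
  -- This `t` maximizes 2ts - t²s(1 + s), the bound that results from 2 S_2 ≤ s².
  set t : ℝ := 1 / (1 + s) with ht
  have hmain : (2 * t - t ^ 2) * s - 2 * t ^ 2 * spacingMoment n a 2
      - (if Even m then spacingMoment n a (m + 1) else 0)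
      ≤ ∑ k ∈ Finset.Icc 1 m, (-1 : ℝ) ^ (k + 1) * spacingMoment n a k := by
    calc _ = ∑ j ∈ Finset.range (n + 1), spacingWeight n a j *
          ((2 * t - t ^ 2) * j - 2 * t ^ 2 * (j.choose 2 : ℝ)
            - (if Even m then (j.choose (m + 1) : ℝ) else 0)) := by
          rw [hs, ← sum_spacingWeight_mul_choose n a 1, ← sum_spacingWeight_mul_choose n a 2,
            ← sum_spacingWeight_mul_choose n a (m + 1)]
          simp only [mul_sub, Finset.sum_sub_distrib, Nat.choose_one_right]
          congr 1
          · congr 1 <;> rw [Finset.mul_sum] <;> exact Finset.sum_congr rfl fun _ _ => by ring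
          · split_ifs <;> simp
      _ ≤ ∑ j ∈ Finset.range (n + 1), spacingWeight n a j *
          ∑ k ∈ Finset.Icc 1 m, (-1 : ℝ) ^ (k + 1) * (j.choose k : ℝ) :=
        Finset.sum_le_sum fun j _ => mul_le_mul_of_nonneg_left (le_alternating_sum_choose m j t)
          (spacingWeight_nonneg hn ha j)
      _ = _ := by
        simp_rw [← sum_spacingWeight_mul_choose n a, Finset.mul_sum]
        rw [Finset.sum_comm]
        exact Finset.sum_congr rfl fun _ _ => Finset.sum_congr rfl fun _ _ => by ring
  have h2 := spacingMoment_two_le (show 1 ≤ n by omega) ha1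
  have h3 : s / (1 + s) ≤ (2 * t - t ^ 2) * s - 2 * t ^ 2 * spacingMoment n a 2 := by
    have : s / (1 + s) = (2 * t - t ^ 2) * s - t ^ 2 * s ^ 2 := by
      rw [ht]; field_simp; ring
    rw [this]
    nlinarith [sq_nonneg t, mul_le_mul_of_nonneg_left h2 (sq_nonneg t)]
  linarith

theorem failBound_eq_sum_spacingMoment (n : ℕ) {h : ℝ} (hh : 0 < h) :
    failBound n h
      = ∑ k ∈ Finset.Icc 1 ⌊h⌋₊, (-1 : ℝ) ^ (k + 1) * spacingMoment n (1 / (2 * h)) k := by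
  unfold failBound spacingMoment
  refine Finset.sum_congr rfl fun k hk => ?_
  have hk' : (k : ℝ) ≤ h := (Nat.cast_le.2 (Finset.mem_Icc.1 hk).2).trans (Nat.floor_le hh.le)
  have : (k : ℝ) / (2 * h) ≤ 1 := by rw [div_le_one (by positivity)]; linarith
  rw [max_eq_left, mul_one_div, mul_assoc]
  rw [mul_one_div]; linarith

/-! ### Numerical estimates for the first omitted moment -/

theorem choose_nine_add_le (i : ℕ) : ∀ k, (9 + i).choose k ≤ 126 * 2 ^ i := by
  induction i with
  | zero =>
    intro k
    rcases Nat.lt_or_ge 9 k with hk | hk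
    · simp [Nat.choose_eq_zero_of_lt hk]
    · interval_cases k <;> decide
  | succ i ih =>
    intro k
    cases k with
    | zero => rw [Nat.choose_zero_right]; have := Nat.one_le_two_pow (n := i + 1); omega
    | succ k =>
      rw [← add_assoc, Nat.choose_succ_succ', pow_succ]
      have h1 := ih k
      have h2 := ih (k + 1)
      omega

/-- The value 63/128 = C(9, 4)/2⁸ is below 1/2, which leaves 3/4 - 63/128 > 1/4 when s ≥ 3. The
condition on `j` excludes C(8, 4)/2⁷ = 70/128, which is too large. -/
theorem choose_mul_half_pow_le {n j : ℕ} (hj : 5 ≤ j) :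
    (n.choose j : ℝ) * (1 / 2) ^ (n - 1) ≤ 63 / 128 := by
  rcases Nat.lt_or_ge n 9 with hn | hn
  · rcases Nat.lt_or_ge 8 j with hj' | hj'
    · rw [Nat.choose_eq_zero_of_lt (by omega)]; norm_num
    · interval_cases n <;> interval_cases j <;> norm_num [Nat.choose]
  · obtain ⟨i, rfl⟩ := Nat.exists_eq_add_of_le hn
    have h : ((9 + i).choose j : ℝ) ≤ 126 * 2 ^ i := by exact_mod_cast choose_nine_add_le i j
    calc ((9 + i).choose j : ℝ) * (1 / 2) ^ (9 + i - 1)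
        ≤ (126 * 2 ^ i) * (1 / 2) ^ (9 + i - 1) := by gcongr
      _ = 126 * (1 / 2) ^ 8 * (2 * (1 / 2)) ^ i := by
        rw [show 9 + i - 1 = 8 + i by omega, pow_add, mul_pow]; ring
      _ = 63 / 128 := by norm_num

/-- Bernoulli with exponent j/5 reduces to the case j = 5 in the variable x = ja. The tangent line
of (1 - x/5)⁵ at x = 1/2 finishes, because 0.847 · 0.9⁵ is just above 1/2. -/
theorem one_sub_mul_le_mul_pow {j : ℕ} (hj : 5 ≤ j) {a : ℝ} (ha : a ≤ 1) (hja : 1 / 2 ≤ j * a)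
    (hja1 : j * a ≤ 1) : 1 - j * a ≤ 847 / 1000 * (1 - a) ^ j := by
  have hj5 : (5 : ℝ) ≤ j := by exact_mod_cast hj
  have h1 : (1 - j * a / 5) ^ 5 ≤ (1 - a) ^ j := by
    have hB := one_add_mul_self_le_rpow_one_add (s := -a) (by linarith) (p := (j : ℝ) / 5)
      (by linarith)
    have h0 : 0 ≤ 1 + (j : ℝ) / 5 * -a := by linarith
    have := pow_le_pow_left₀ h0 hB 5
    rw [← Real.rpow_natCast _ 5, ← Real.rpow_natCast _ 5,
      ← Real.rpow_mul (by linarith : (0 : ℝ) ≤ 1 + -a)] at this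
    have he : (j : ℝ) / 5 * ((5 : ℕ) : ℝ) = (j : ℕ) := by push_cast; ring
    rw [he, Real.rpow_natCast, Real.rpow_natCast] at this
    rwa [show 1 + (j : ℝ) / 5 * -a = 1 - j * a / 5 by ring, ← sub_eq_add_neg] at this
  refine le_trans ?_ (mul_le_mul_of_nonneg_left h1 (by norm_num))
  set x := (j : ℝ) * a
  have h2 := one_add_mul_le_pow (a := (1 - x / 5) / (9 / 10) - 1)
    (by have : 0 ≤ (1 - x / 5) / (9 / 10) := by apply div_nonneg <;> linarith
        linarith) 5
  have h3 : (1 + ((1 - x / 5) / (9 / 10) - 1)) ^ 5 = (1 - x / 5) ^ 5 / (9 / 10) ^ 5 := by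
    rw [add_sub_cancel, div_pow]
  rw [h3, le_div_iff₀ (by norm_num)] at h2
  push_cast at h2
  nlinarith

theorem pow_div_factorial_le {s : ℝ} (hs : 0 ≤ s) (hs3 : s ≤ 3) {j : ℕ} (hj : 5 ≤ j) :
    s ^ j / (j.factorial : ℝ) ≤ 27 / 40 * s := by
  induction j, hj using Nat.le_induction with
  | base =>
    have : s ^ 4 ≤ 3 ^ 4 := by gcongr
    norm_num [Nat.factorial]
    nlinarith
  | succ j hj ih =>
    refine le_trans ?_ ih
    rw [Nat.factorial_succ, pow_succ, Nat.cast_mul, mul_comm ((j + 1 : ℕ) : ℝ), mul_div_mul_comm]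
    refine mul_le_of_le_one_right (by positivity) ?_
    rw [div_le_one (by positivity)]
    have : (5 : ℝ) ≤ j := by exact_mod_cast hj
    push_cast; linarith

theorem spacingMoment_le_of_lt_three {n j : ℕ} (hn : 11 ≤ n) (hj : 5 ≤ j) {a : ℝ}
    (ha : a ≤ 1) (hja : 1 / 2 ≤ j * a) (hja1 : j * a ≤ 1) {s : ℝ}
    (hs : s = n * (1 - a) ^ (n - 1)) (hs3 : s < 3) :
    spacingMoment n a j ≤ 11 / 100 * s := by
  have hs0 : 0 ≤ s := by
    rw [hs]; have : 0 ≤ 1 - a := by linarith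
    positivity
  have hn0 : (0 : ℝ) < n := by exact_mod_cast (by omega : 0 < n)
  have hmain : spacingMoment n a j ≤ (n.choose j : ℝ) * (847 / 1000) ^ (n - 1) * (s / n) ^ j := by
    unfold spacingMoment
    rw [max_eq_left (by linarith)]
    calc (n.choose j : ℝ) * (1 - j * a) ^ (n - 1)
        ≤ (n.choose j : ℝ) * (847 / 1000 * (1 - a) ^ j) ^ (n - 1) := by
          have := one_sub_mul_le_mul_pow hj ha hja hja1
          have : 0 ≤ 1 - j * a := by linarith
          gcongr
      _ = _ := by
        rw [hs, mul_div_cancel_left₀ _ hn0.ne', mul_pow, ← pow_mul, ← pow_mul, mul_comm j, mul_assoc]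
  -- For n = 11 the bound C(n, j) ≤ n^j/j! is too weak, so the exact maximum C(11, 5) = 462 replaces
  -- it.
  rcases Nat.lt_or_ge n 12 with h12 | h12
  · obtain rfl : n = 11 := by omega
    have hc : ((11 : ℕ).choose j : ℝ) ≤ 462 := by
      have : Nat.choose 11 j ≤ 462 := by
        rcases Nat.lt_or_ge 11 j with hk | hk
        · simp [Nat.choose_eq_zero_of_lt hk]
        · interval_cases j <;> decide
      exact_mod_cast this
    have hp : (s / (11 : ℕ)) ^ j ≤ (s / (11 : ℕ)) ^ 5 := by
      refine pow_le_pow_of_le_one (by positivity) ?_ hj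
      push_cast; linarith
    have h4 : s ^ 4 ≤ 3 ^ 4 := by gcongr
    calc _ ≤ _ := hmain
      _ ≤ 462 * (847 / 1000) ^ (11 - 1) * (s / (11 : ℕ)) ^ 5 := by gcongr
      _ = 462 * (847 / 1000) ^ 10 / 11 ^ 5 * s ^ 4 * s := by push_cast; ring
      _ ≤ 462 * (847 / 1000) ^ 10 / 11 ^ 5 * 3 ^ 4 * s := by gcongr
      _ ≤ _ := by gcongr; norm_num
  · have hc : (n.choose j : ℝ) ≤ (n : ℝ) ^ j / (j.factorial : ℝ) := Nat.choose_le_pow_div j n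
    have hq : ((847 : ℝ) / 1000) ^ (n - 1) ≤ (847 / 1000) ^ 11 :=
      pow_le_pow_of_le_one (by norm_num) (by norm_num) (by omega)
    calc _ ≤ _ := hmain
      _ ≤ (n : ℝ) ^ j / (j.factorial : ℝ) * (847 / 1000) ^ 11 * (s / n) ^ j := by gcongr
      _ = (847 / 1000) ^ 11 * (s ^ j / (j.factorial : ℝ)) := by
        rw [div_pow s]; field_simp
      _ ≤ (847 / 1000) ^ 11 * (27 / 40 * s) := by
        gcongr; exact pow_div_factorial_le hs0 hs3.le hj
      _ ≤ _ := by
        rw [← mul_assoc]; gcongr; norm_num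

theorem natCast_mul_four_fifths_pow_le {n : ℕ} (hn : 6 ≤ n) :
    (n : ℝ) * (4 / 5) ^ (n - 1) ≤ 2 := by
  induction n, hn using Nat.le_induction with
  | base => norm_num
  | succ n hn ih =>
    refine le_trans ?_ ih
    obtain ⟨k, rfl⟩ := Nat.exists_eq_add_of_le' hn
    simp only [Nat.add_sub_cancel, show k + 6 - 1 = k + 5 by omega]
    rw [pow_succ (4 / 5 : ℝ) (k + 5)]
    have : (0 : ℝ) ≤ (4 / 5) ^ (k + 5) := by positivity
    have hk : (0 : ℝ) ≤ k := by positivity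
    push_cast
    nlinarith

theorem three_le_mul_seven_eighths_pow {n : ℕ} (h6 : 6 ≤ n) (h10 : n ≤ 10) :
    3 ≤ n * (7 / 8 : ℝ) ^ (n - 1) := by
  interval_cases n <;> norm_num

theorem bounds_of_div_one_add_le {s p γ : ℝ} (hs0 : 0 ≤ s) (hps : p ≤ s)
    (hγ : s / (1 + s) ≤ γ) : 0 ≤ γ ∧ (γ < 1 / 4 → p ≤ 2 * γ) := by
  have h0 : 0 ≤ s / (1 + s) := by positivity
  refine ⟨h0.trans hγ, fun hlt => ?_⟩
  have h1 : s / (1 + s) < 1 / 4 := hγ.trans_lt hlt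
  rw [div_lt_iff₀ (by linarith)] at h1
  have h2 : s / 2 ≤ s / (1 + s) := by gcongr; linarith
  linarith

theorem bounds_of_sub_spacingMoment_le {n m : ℕ} (hm4 : 4 ≤ m) {a : ℝ} (ha0 : 0 < a)
    (hma : (m : ℝ) * a ≤ 1 / 2) (hma' : 1 / 2 ≤ ((m + 1 : ℕ) : ℝ) * a) {s p γ : ℝ}
    (hs : s = n * (1 - a) ^ (n - 1)) (hs0 : 0 ≤ s) (hps : p ≤ s) (hp0 : 0 ≤ p)
    (hps2 : p * n ≤ s ^ 2)
    (hlow : s / (1 + s) - spacingMoment n a (m + 1) ≤ γ) :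
    0 ≤ γ ∧ (γ < 1 / 4 → p ≤ 2 * γ) := by
  have hj : 5 ≤ m + 1 := by omega
  have hm4' : (4 : ℝ) ≤ m := by exact_mod_cast hm4
  have ha8 : a ≤ 1 / 8 := by nlinarith
  have hja1 : ((m + 1 : ℕ) : ℝ) * a ≤ 1 := by push_cast; linarith
  have hS : spacingMoment n a (m + 1) ≤ (n.choose (m + 1) : ℝ) * (1 / 2) ^ (n - 1) := by
    unfold spacingMoment
    rw [max_eq_left (by linarith)]
    have : 0 ≤ 1 - ((m + 1 : ℕ) : ℝ) * a := by linarith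
    gcongr; linarith
  have hS' := hS.trans (choose_mul_half_pow_le hj)
  rcases le_or_gt 3 s with hs3 | hs3
  · have : 3 / 4 ≤ s / (1 + s) := by rw [div_le_div_iff₀ (by norm_num) (by linarith)]; linarith
    exact ⟨by linarith, fun hlt => by linarith⟩
  · rcases Nat.lt_or_ge n 11 with h11 | h11
    · rcases Nat.lt_or_ge n (m + 1) with hnm | hnm
      · refine bounds_of_div_one_add_le hs0 hps ?_
        simpa [spacingMoment, Nat.choose_eq_zero_of_lt hnm] using hlow
      · have hsl : n * (7 / 8 : ℝ) ^ (n - 1) ≤ s := by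
          rw [hs]; gcongr; linarith
        have hn5 : 5 ≤ n := by omega
        -- Here a ≤ 1/8 gives s ≥ n(7/8)^(n-1), which is at least 3 for n from 6 to 10. Only n = 5
        -- is compatible with s < 3.
        obtain rfl : n = 5 := by
          by_contra hne
          exact hs3.not_ge ((three_le_mul_seven_eighths_pow (by omega) (by omega)).trans hsl)
        have hm5 : m = 4 := by omega
        rw [hm5] at hS hlow
        norm_num at hS hsl
        have : 7 / 10 ≤ s / (1 + s) := by
          rw [div_le_div_iff₀ (by norm_num) (by linarith)]; linarith
        norm_num at hlow
        exact ⟨by linarith, fun hlt => by linarith⟩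
    · have hSs := spacingMoment_le_of_lt_three h11 hj (by linarith) hma' hja1 hs hs3
      have hn11 : (11 : ℝ) ≤ n := by exact_mod_cast h11
      have h4 : s / 4 ≤ s / (1 + s) := by gcongr; linarith
      have hp11 : p * 11 ≤ 3 * s := by nlinarith
      -- The margin is narrow: γ ≥ (1/4 - 11/100)s gives 2γ ≥ 0.28 s, while p ≤ (3/11)s.
      exact ⟨by linarith, fun hlt => by linarith⟩

/-- The bounds on `failBound n h` that link it to the union bound for uncovered sets. -/
theorem failBound_bounds {n : ℕ} (hn : 2 ≤ n) {h : ℝ} (hh : 1 ≤ h) :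
    0 ≤ failBound n h ∧
      (failBound n h < 1 / 4 → (n : ℝ) * (1 - 1 / h) ^ (n - 1) ≤ 2 * failBound n h) := by
  set a : ℝ := 1 / (2 * h) with ha
  have hh0 : 0 < h := by linarith
  have ha0 : 0 < a := by positivity
  have hah : a * h = 1 / 2 := by rw [ha]; field_simp
  have ha2 : a ≤ 1 / 2 := by nlinarith
  have h2a : 1 / h = 2 * a := by rw [ha]; field_simp
  rw [h2a]
  have hn2 : (2 : ℝ) ≤ n := by exact_mod_cast hn
  set m := ⌊h⌋₊ with hm
  have hm1 : 1 ≤ m := Nat.one_le_floor_iff h |>.2 hh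
  have hmh : (m : ℝ) ≤ h := Nat.floor_le hh0.le
  have hmh' : h < m + 1 := Nat.lt_floor_add_one h
  have hma : (m : ℝ) * a ≤ 1 / 2 := by rw [← hah, mul_comm a]; gcongr
  have hma' : 1 / 2 ≤ ((m + 1 : ℕ) : ℝ) * a := by
    rw [← hah, mul_comm a]; push_cast; gcongr
  set s : ℝ := n * (1 - a) ^ (n - 1) with hs
  have hs1 : spacingMoment n a 1 = s := by
    simp only [spacingMoment, Nat.choose_one_right, Nat.cast_one, one_mul]
    rw [max_eq_left (by linarith)]
  have h1a : 0 ≤ 1 - a := by linarith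
  have h12a : 0 ≤ 1 - 2 * a := by linarith
  have hs0 : 0 ≤ s := by positivity
  set p : ℝ := n * (1 - 2 * a) ^ (n - 1) with hp
  have hp0 : 0 ≤ p := by positivity
  have hps : p ≤ s := by
    rw [hp, hs]; gcongr; linarith
  have hps2 : p * n ≤ s ^ 2 := by
    have : 1 - 2 * a ≤ (1 - a) ^ 2 := by nlinarith
    calc p * n = (n : ℝ) ^ 2 * (1 - 2 * a) ^ (n - 1) := by rw [hp]; ring
      _ ≤ (n : ℝ) ^ 2 * ((1 - a) ^ 2) ^ (n - 1) := by gcongr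
      _ = s ^ 2 := by rw [hs, mul_pow, pow_right_comm]
  have hlow := le_alternating_sum_spacingMoment hn ha0.le (by linarith : a ≤ 1) m
  rw [← failBound_eq_sum_spacingMoment n hh0, hs1] at hlow
  set γ := failBound n h with hγ
  rcases Nat.even_or_odd m with hev | hodd
  swap
  · rw [if_neg (Nat.not_even_iff_odd.2 hodd), sub_zero] at hlow
    exact bounds_of_div_one_add_le hs0 hps hlow
  rw [if_pos hev] at hlow
  rcases Nat.lt_or_ge m 4 with hm4 | hm4
  · have hm2 : m = 2 := by
      obtain ⟨r, hr⟩ := hev; omega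
    have hγ2 : γ = s - (n - 1) / 2 * p := by
      rw [hγ, failBound_eq_sum_spacingMoment n hh0, ← hm, hm2, ← ha]
      have : Finset.Icc 1 2 = ({1, 2} : Finset ℕ) := by decide
      rw [this, Finset.sum_pair (by decide), hs1]
      simp only [spacingMoment, Nat.cast_choose_two, Nat.cast_ofNat]
      rw [max_eq_left h12a, hp]
      ring
    rw [hm2] at hma hma'
    push_cast at hma hma'
    have ha6 : 1 / 6 ≤ a := by linarith
    have hpq : p ≤ (4 / 5) ^ (n - 1) * s := by
      calc p ≤ n * (4 / 5 * (1 - a)) ^ (n - 1) := by rw [hp]; gcongr; linarith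
        _ = _ := by rw [hs, mul_pow]; ring
    -- If np ≤ 2s, then γ = s - (n-1)p/2 ≥ p/2. The condition n(4/5)^(n-1) ≤ 2 fails only for n = 4
    -- and n = 5, where the lower bound on s from a ≤ 1/4 forces γ > 1/4 instead.
    have hgood : (n : ℝ) * (4 / 5) ^ (n - 1) ≤ 2 → 0 ≤ γ ∧ (γ < 1 / 4 → p ≤ 2 * γ) := by
      intro hle
      have : n * p ≤ 2 * s := by
        calc n * p ≤ n * ((4 / 5) ^ (n - 1) * s) := by gcongr
          _ = (n * (4 / 5) ^ (n - 1)) * s := by ring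
          _ ≤ _ := by gcongr
      constructor
      · nlinarith
      · intro _; nlinarith
    rcases Nat.lt_or_ge n 6 with h6 | h6
    · have hsl : n * (3 / 4 : ℝ) ^ (n - 1) ≤ s := by
        rw [hs]; gcongr; linarith
      interval_cases n
      · exact hgood (by norm_num)
      · exact hgood (by norm_num)
      · norm_num at hsl hpq hγ2
        constructor
        · linarith
        · intro _; linarith
      · norm_num at hsl hpq hγ2
        constructor
        · linarith
        · intro _; linarith
    · exact hgood (natCast_mul_four_fifths_pow_le h6)
  · exact bounds_of_sub_spacingMoment_le hm4 ha0 hma hma' hs hs0 hps hp0 hps2 hlow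

/-! ### Covering the circle by random arcs -/

/-- The open arc of length `w` with left end point `0`. -/
def openArc (w : ℝ) : Set UnitAddCircle :=
  (fun r : ℝ => (r : UnitAddCircle)) '' Set.Ioo 0 w

theorem isOpen_openArc (w : ℝ) : IsOpen (openArc w) :=
  QuotientAddGroup.isOpenMap_coe _ isOpen_Ioo

theorem volume_compl_openArc_le (w : ℝ) :
    volume (openArc w)ᶜ ≤ ENNReal.ofReal (1 - w) := by
  have hm := UnitAddCircle.measurePreserving_mk 0
  rw [← hm.measure_preimage (isOpen_openArc w).measurableSet.compl.nullMeasurableSet,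
    Measure.restrict_apply' measurableSet_Ioc]
  calc _ ≤ volume (Set.Icc w 1) := by
        refine measure_mono fun r hr => ?_
        simp only [zero_add] at hr
        refine ⟨not_lt.1 fun hlt => hr.1 ⟨r, ⟨hr.2.1, hlt⟩, rfl⟩, hr.2.2⟩
    _ = _ := Real.volume_Icc

theorem UnitAddCircle.exists_coe_eq (x : UnitAddCircle) :
    ∃ r : ℝ, r ∈ Set.Ico (0 : ℝ) 1 ∧ (r : UnitAddCircle) = x := by
  have h := AddCircle.coe_image_Ico_eq (p := (1 : ℝ)) 0
  have hx : x ∈ ((↑) : ℝ → AddCircle (1 : ℝ)) '' Set.Ico 0 (0 + 1) := by rw [h]; trivial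
  simpa using hx

/-- If every point of a family is followed, within distance less than `w`, by another point of
the family, then each family with one point removed is still `w`-dense. -/
theorem exists_ne_norm_sub_lt {ι : Type*} [Finite ι] [Nontrivial ι] {w : ℝ}
    {x : ι → UnitAddCircle} (hx : ∀ j, ∃ l ≠ j, x l - x j ∈ openArc w) (i : ι)
    (y : UnitAddCircle) : ∃ j ≠ i, ‖y - x j‖ < w := by
  have hlift : ∀ l, ∃ r : ℝ, r ∈ Set.Ico (0 : ℝ) 1 ∧ (r : UnitAddCircle) = y - x l :=
    fun l => UnitAddCircle.exists_coe_eq _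
  choose s hs01 hs using hlift
  have huniq : ∀ l (r : ℝ), r ∈ Set.Ico (0 : ℝ) 1 → (r : UnitAddCircle) = y - x l → s l = r := by
    intro l r hr h
    have := AddCircle.coe_eq_coe_iff_of_mem_Ico (p := (1 : ℝ)) (a := 0) (x := s l) (y := r)
      (by simpa using hs01 l) (by simpa using hr)
    exact this.1 (by rw [hs, h])
  -- The node x_j is the last remaining one met before `y` in the positive direction.
  obtain ⟨j, hji, hjmin⟩ := Set.exists_min_image {l | l ≠ i} s (Set.toFinite _) (exists_ne i)
  by_contra! hfar
  have hnorm : ∀ r : ℝ, ‖(r : UnitAddCircle)‖ ≤ |r| := fun r => by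
    rw [UnitAddCircle.norm_eq]
    simpa using round_le r 0
  have hsj : w ≤ s j := by
    have h1 := hfar j hji
    rw [← hs j] at h1
    have h2 := hnorm (s j)
    rw [abs_of_nonneg (hs01 j).1] at h2
    linarith
  -- A remaining node within 2w after x_j would either lie between x_j and `y`, against minimality,
  -- or lie beyond `y` by less than 2w - w = w.
  have hclose : ∀ l ≠ i, ∀ r, 0 < r → r < 2 * w → x l = x j + (r : UnitAddCircle) → False := by
    intro l hl r hr0 hr2 hxl
    have hy : ((s j - r : ℝ) : UnitAddCircle) = y - x l := by
      rw [AddCircle.coe_sub, hs j, hxl]; abel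
    rcases le_or_gt r (s j) with h | h
    · have := huniq l (s j - r) ⟨by linarith, by have := (hs01 j).2; linarith⟩ hy
      have := hjmin l hl
      linarith
    · have h1 := hfar l hl
      rw [← hy] at h1
      have h2 := hnorm (s j - r)
      rw [abs_of_neg (by linarith)] at h2
      linarith
  obtain ⟨l, hlj, r, ⟨hr0, hrw⟩, hr⟩ := hx j
  have hxl : x l = x j + (r : UnitAddCircle) := by
    simp only at hr; rw [hr]; abel
  -- If the successor of x_j is the removed node, the successor of that node is still within 2w.
  by_cases hli : l = i
  · obtain ⟨l', hl', r', ⟨hr0', hrw'⟩, hr'⟩ := hx l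
    refine hclose l' (hli ▸ hl') (r + r') (by linarith) (by linarith) ?_
    simp only at hr'
    rw [AddCircle.coe_add, ← add_assoc, ← hxl, hr']; abel
  · exact hclose l hli r hr0 (by linarith) hxl

/-- Conditioning on the `j`-th coordinate makes the slice a product of translates of the complement,
whose measures do not depend on that coordinate. -/
theorem volume_pi_forall_sub_notMem_le {N : ℕ} (j : Fin (N + 1)) {A : Set UnitAddCircle}
    (hA : MeasurableSet A) :
    (Measure.pi fun _ : Fin (N + 1) => (volume : Measure UnitAddCircle))
      {x | ∀ l ≠ j, x l - x j ∉ A} = volume Aᶜ ^ N := by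
  have hmp := measurePreserving_piFinSuccAbove
    (fun _ : Fin (N + 1) => (volume : Measure UnitAddCircle)) j
  set S : Set (UnitAddCircle × (Fin N → UnitAddCircle)) := {q | ∀ i, q.2 i - q.1 ∉ A} with hS
  have hSm : MeasurableSet S := by
    have : S = ⋂ i, {q | q.2 i - q.1 ∉ A} := by ext; simp [hS]
    rw [this]
    refine MeasurableSet.iInter fun i => ?_
    have hmeas : Measurable fun q : UnitAddCircle × (Fin N → UnitAddCircle) => q.2 i - q.1 := by
      fun_prop
    exact hmeas hA.compl
  have hpre : {x : Fin (N + 1) → UnitAddCircle | ∀ l ≠ j, x l - x j ∉ A}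
      = MeasurableEquiv.piFinSuccAbove (fun _ => UnitAddCircle) j ⁻¹' S := by
    ext x
    simp only [Set.mem_ofPred_eq, hS, Set.mem_preimage]
    constructor
    · intro h i
      exact h _ (Fin.succAbove_ne j i)
    · intro h l hl
      obtain ⟨i, rfl⟩ := Fin.exists_succAbove_eq hl
      exact h i
  rw [hpre, hmp.measure_preimage hSm.nullMeasurableSet, Measure.prod_apply hSm]
  have hslice : ∀ t : UnitAddCircle,
      (Measure.pi fun _ : Fin N => (volume : Measure UnitAddCircle)) (Prod.mk t ⁻¹' S)
        = volume Aᶜ ^ N := by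
    intro t
    have : Prod.mk t ⁻¹' S = Set.univ.pi fun _ => (fun y => y - t) ⁻¹' Aᶜ := by
      ext; simp [hS]
    have hsub : ∀ t : UnitAddCircle, volume ((fun y => y - t) ⁻¹' Aᶜ) = volume Aᶜ := fun t => by
      simp_rw [sub_eq_add_neg]
      exact measure_preimage_add_right _ _ _
    rw [this, Measure.pi_pi]
    simp_rw [hsub, Finset.prod_const, Finset.card_univ, Fintype.card_fin]
  simp [hslice]

theorem measure_exists_forall_sub_notMem_openArc_le {Ω : Type*} [MeasurableSpace Ω]
    {P : Measure Ω} [IsProbabilityMeasure P] {n : ℕ} {X : Fin n → Ω → UnitAddCircle}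
    (hX_law : ∀ i, HasLaw (X i) (volume : Measure UnitAddCircle) P) (hX_indep : iIndepFun X P)
    {w : ℝ} (hw : w ≤ 1) :
    P.real {ω | ∃ j, ∀ l ≠ j, X l ω - X j ω ∉ openArc w} ≤ n * (1 - w) ^ (n - 1) := by
  have hmap := (iIndepFun_iff_map_fun_eq_pi_map fun i => (hX_law i).aemeasurable).1 hX_indep
  simp_rw [fun i => (hX_law i).map_eq] at hmap
  have hXm : AEMeasurable (fun ω i => X i ω) P :=
    aemeasurable_pi_lambda _ fun i => (hX_law i).aemeasurable
  have hA := (isOpen_openArc w).measurableSet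
  have hone : ∀ j, P.real {ω | ∀ l ≠ j, X l ω - X j ω ∉ openArc w} ≤ (1 - w) ^ (n - 1) := by
    intro j
    obtain ⟨N, rfl⟩ : ∃ N, n = N + 1 := ⟨n - 1, by have := j.2; omega⟩
    refine ENNReal.toReal_le_of_le_ofReal (by have : 0 ≤ 1 - w := by linarith
                                              positivity) ?_
    have hm : MeasurableSet {x : Fin (N + 1) → UnitAddCircle | ∀ l ≠ j, x l - x j ∉ openArc w} := by
      have : {x : Fin (N + 1) → UnitAddCircle | ∀ l ≠ j, x l - x j ∉ openArc w}
          = ⋂ l, ⋂ (_ : l ≠ j), {x | x l - x j ∉ openArc w} := by ext; simp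
      rw [this]
      refine MeasurableSet.iInter fun l => MeasurableSet.iInter fun _ => ?_
      have hmeas : Measurable fun x : Fin (N + 1) → UnitAddCircle => x l - x j := by fun_prop
      exact hmeas hA.compl
    calc P {ω | ∀ l ≠ j, X l ω - X j ω ∉ openArc w}
        = P.map (fun ω i => X i ω) {x | ∀ l ≠ j, x l - x j ∉ openArc w} :=
          (Measure.map_apply_of_aemeasurable hXm hm).symm
      _ = volume (openArc w)ᶜ ^ N := by rw [hmap, volume_pi_forall_sub_notMem_le j hA]
      _ ≤ ENNReal.ofReal (1 - w) ^ N := by gcongr; exact volume_compl_openArc_le w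
      _ = ENNReal.ofReal ((1 - w) ^ (N + 1 - 1)) := by
        rw [Nat.add_sub_cancel, ENNReal.ofReal_pow (by linarith)]
  have hset : {ω | ∃ j, ∀ l ≠ j, X l ω - X j ω ∉ openArc w}
      = ⋃ j, {ω | ∀ l ≠ j, X l ω - X j ω ∉ openArc w} := by ext; simp
  rw [hset]
  refine (measureReal_iUnion_fintype_le _).trans ?_
  refine (Finset.sum_le_sum fun j _ => hone j).trans ?_
  simp

/-! ### Pointwise error of Shepard's model -/

theorem radialKernel_nonneg (k : ℝ≥0 → ℝ≥0) (x y : UnitAddCircle) : 0 ≤ radialKernel k x y :=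
  NNReal.coe_nonneg _

theorem dist_le_of_radialKernel_ne_zero {k : ℝ≥0 → ℝ≥0} {r : ℝ}
    (hk : tsupport k = {t : ℝ≥0 | (t : ℝ) ≤ r}) {x y : UnitAddCircle}
    (hxy : radialKernel k x y ≠ 0) : dist x y ≤ r := by
  have h : nndist x y ∈ tsupport k := subset_tsupport k fun h0 => hxy (by
    unfold radialKernel; rw [h0]; rfl)
  rw [hk] at h
  simpa using h

section Shepard

variable {ι : Type*} [Fintype ι] {k : ℝ≥0 → ℝ≥0} {f : UnitAddCircle → ℝ}
  {z : ι → UnitAddCircle × ℝ} {x : UnitAddCircle}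

theorem abs_shepard_sub_le {L : ℝ≥0} (hf : LipschitzWith L f) {r : ℝ}
    (hk : tsupport k = {t : ℝ≥0 | (t : ℝ) ≤ r}) (hz : ∀ j, (z j).2 = f (z j).1)
    (hx : ∑ j, radialKernel k x (z j).1 ≠ 0) : |shepard k z x - f x| ≤ L * r := by
  have hD : 0 < ∑ j, radialKernel k x (z j).1 :=
    lt_of_le_of_ne (Finset.sum_nonneg fun j _ => radialKernel_nonneg _ _ _) hx.symm
  have heq : shepard k z x - f x
      = (∑ j, radialKernel k x (z j).1 * (f (z j).1 - f x)) / ∑ j, radialKernel k x (z j).1 := by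
    unfold shepard
    rw [div_sub' hx]
    simp_rw [mul_sub, Finset.sum_sub_distrib, ← Finset.sum_mul, hz]
  rw [heq, abs_div, abs_of_pos hD, div_le_iff₀ hD, Finset.mul_sum]
  refine (Finset.abs_sum_le_sum_abs _ _).trans (Finset.sum_le_sum fun j _ => ?_)
  rw [abs_mul, abs_of_nonneg (radialKernel_nonneg _ _ _), mul_comm]
  by_cases h0 : radialKernel k x (z j).1 = 0
  · simp [h0]
  · refine mul_le_mul_of_nonneg_right ?_ (radialKernel_nonneg _ _ _)
    have h1 := hf.dist_le_mul x (z j).1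
    rw [dist_comm, Real.dist_eq] at h1
    exact h1.trans (mul_le_mul_of_nonneg_left (dist_le_of_radialKernel_ne_zero hk h0) L.2)

theorem sum_radialKernel_ne_zero {r : ℝ} (hk : ∀ t : ℝ≥0, (t : ℝ) < r → 0 < k t)
    (hx : ∃ j, ‖x - (z j).1‖ < r) : ∑ j, radialKernel k x (z j).1 ≠ 0 := by
  obtain ⟨j, hj⟩ := hx
  refine (Finset.sum_pos' (fun j _ => radialKernel_nonneg _ _ _) ⟨j, Finset.mem_univ j, ?_⟩).ne'
  exact NNReal.coe_pos.2 (hk _ (by rwa [coe_nndist, dist_eq_norm]))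

theorem abs_le_uniformNorm (hf : Continuous f) (x : UnitAddCircle) : |f x| ≤ uniformNorm f :=
  le_ciSup (f := fun y => |f y|) (isCompact_range hf.abs).bddAbove x

theorem sq_abs_shepard_sub_le {L : ℝ≥0} (hf : LipschitzWith L f) {r : ℝ}
    (hk : tsupport k = {t : ℝ≥0 | (t : ℝ) ≤ r}) (hz : ∀ j, (z j).2 = f (z j).1) :
    |shepard k z x - f x| ^ 2 ≤ max ((L * r) ^ 2) (uniformNorm f ^ 2) := by
  by_cases hx : ∑ j, radialKernel k x (z j).1 = 0
  · refine le_max_of_le_right (pow_le_pow_left₀ (abs_nonneg _) ?_ 2)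
    unfold shepard
    rw [hx, div_zero, zero_sub, abs_neg]
    exact abs_le_uniformNorm hf.continuous x
  · exact le_max_of_le_left (pow_le_pow_left₀ (abs_nonneg _) (abs_shepard_sub_le hf hk hz hx) 2)

end Shepard

/-! ### Cross-validation score against risk -/

theorem risk_nonneg (f g : UnitAddCircle → ℝ) : 0 ≤ risk f g :=
  integral_nonneg fun _ => sq_nonneg _

theorem risk_le {f g : UnitAddCircle → ℝ} {C : ℝ} (h : ∀ x, |g x - f x| ^ 2 ≤ C) :
    risk f g ≤ C := by
  have := integral_mono_of_nonneg (μ := (volume : Measure UnitAddCircle))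
    (f := fun x => |g x - f x| ^ 2) (g := fun _ => C)
    (Filter.Eventually.of_forall fun _ => sq_nonneg _) (integrable_const C)
    (Filter.Eventually.of_forall h)
  simpa [risk, measureReal_def] using this

theorem cvScore_nonneg {n : ℕ} (k : ℝ≥0 → ℝ≥0) (f : UnitAddCircle → ℝ)
    (z : Fin n → UnitAddCircle × ℝ) : 0 ≤ cvScore k f z := by
  unfold cvScore; positivity

theorem cvScore_le {n : ℕ} (hn : n ≠ 0) {k : ℝ≥0 → ℝ≥0} {f : UnitAddCircle → ℝ}
    {z : Fin n → UnitAddCircle × ℝ} {C : ℝ}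
    (h : ∀ i, |shepard k (leaveOut z i) (z i).1 - f (z i).1| ^ 2 ≤ C) : cvScore k f z ≤ C := by
  have hn' : (0 : ℝ) < n := by exact_mod_cast Nat.pos_of_ne_zero hn
  unfold cvScore
  rw [one_div, inv_mul_le_iff₀ hn']
  refine (Finset.sum_le_sum fun i _ => h i).trans ?_
  simp

/-- A uniform bound on the squared errors of all leave-one-out models bounds the difference
between cross-validation score and risk. -/
theorem abs_cvScore_sub_risk_le {n : ℕ} {k : ℝ≥0 → ℝ≥0} {f : UnitAddCircle → ℝ}
    {z : Fin n → UnitAddCircle × ℝ} (i₀ : Fin n) {C : ℝ}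
    (h : ∀ i x, |shepard k (leaveOut z i) x - f x| ^ 2 ≤ C) :
    |cvScore k f z - risk f (shepard k (leaveOut z i₀))| ≤ C := by
  have h1 := cvScore_nonneg k f z
  have h2 := cvScore_le (k := k) (f := f) (z := z) (by have := i₀.2; omega) fun i => h i _
  have h3 := risk_nonneg f (shepard k (leaveOut z i₀))
  have h4 := risk_le (h i₀)
  rw [abs_le]
  constructor <;> linarith

/-- Unless `failBound n h` is large, it bounds the probability that the leave-one-out score and
the risk differ by more than the squared resolution `(L / h) ^ 2`. -/
theorem measure_resolution_lt_abs_cvScore_sub_risk_le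
    {Ω : Type*} [MeasurableSpace Ω] {P : Measure Ω} [IsProbabilityMeasure P]
    {n : ℕ} (hn : 2 ≤ n) {X : Fin n → Ω → UnitAddCircle}
    (hX_law : ∀ i, HasLaw (X i) (volume : Measure UnitAddCircle) P) (hX_indep : iIndepFun X P)
    {L : ℝ≥0} {f : UnitAddCircle → ℝ} (hf : LipschitzWith L f) {h : ℝ} (hh : 0 < h)
    {k : ℝ≥0 → ℝ≥0} (hk_supp : tsupport k = {t : ℝ≥0 | (t : ℝ) ≤ 1 / h})
    (hk_pos : ∀ t : ℝ≥0, (t : ℝ) < 1 / h → 0 < k t)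
    {Z : Ω → Fin n → UnitAddCircle × ℝ} (hZ : ∀ ω i, Z ω i = (X i ω, f (X i ω))) (i₀ : Fin n) :
    0 ≤ failBound n h ∧ (failBound n h < 1 / 4 →
      P.real {ω | (L * (1 / h)) ^ 2 <
        |cvScore k f (Z ω) - risk f (shepard k (leaveOut (Z ω) i₀))|} ≤ 2 * failBound n h) := by
  have hZf : ∀ ω i (j : {j : Fin n // j ≠ i}),
      (leaveOut (Z ω) i j).2 = f (leaveOut (Z ω) i j).1 := fun ω i j => by
    simp [leaveOut, hZ]
  have hcov : ∀ ω, (∀ i x, ∃ j ≠ i, ‖x - X j ω‖ < 1 / h) →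
      |cvScore k f (Z ω) - risk f (shepard k (leaveOut (Z ω) i₀))| ≤ (L * (1 / h)) ^ 2 := by
    intro ω hω
    refine abs_cvScore_sub_risk_le i₀ fun i x => pow_le_pow_left₀ (abs_nonneg _)
      (abs_shepard_sub_le hf hk_supp (hZf ω i) (sum_radialKernel_ne_zero hk_pos ?_)) 2
    obtain ⟨j, hj, hjx⟩ := hω i x
    exact ⟨⟨j, hj⟩, by simpa [leaveOut, hZ] using hjx⟩
  have : Nontrivial (Fin n) := Fin.nontrivial_iff_two_le.2 hn
  rcases lt_or_ge h 1 with h1 | h1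
  · have h0 : failBound n h = 0 := by
      simp [failBound, Nat.floor_eq_zero.2 h1]
    rw [h0]
    refine ⟨le_rfl, fun _ => ?_⟩
    have hempty : {ω | (L * (1 / h)) ^ 2 <
        |cvScore k f (Z ω) - risk f (shepard k (leaveOut (Z ω) i₀))|} = ∅ := by
      refine Set.eq_empty_of_forall_notMem fun ω hω => (hcov ω fun i x => ?_).not_gt hω
      obtain ⟨j, hj⟩ := exists_ne i
      refine ⟨j, hj, ?_⟩
      have hle : ‖x - X j ω‖ ≤ |(1 : ℝ)| / 2 := AddCircle.norm_le_half_period 1 one_ne_zero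
      have : 1 < 1 / h := by rwa [lt_div_iff₀ hh, one_mul]
      rw [abs_one] at hle
      linarith
    rw [hempty]
    simp
  · obtain ⟨hγ0, hγ⟩ := failBound_bounds hn h1
    refine ⟨hγ0, fun hlt => le_trans ?_ (hγ hlt)⟩
    refine le_trans (measureReal_mono fun ω hω => ?_)
      (measure_exists_forall_sub_notMem_openArc_le hX_law hX_indep
        ((div_le_one hh).2 h1))
    by_contra hc
    simp only [Set.mem_ofPred_eq, not_exists, not_forall, not_not] at hc
    refine (hcov ω fun i x => ?_).not_gt hω
    exact exists_ne_norm_sub_lt (fun j => by simpa using hc j) i x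

/-! ### The two probability bounds -/

/-- The exponential term of the concentration bound is trivial below the squared resolution. -/
theorem one_le_two_mul_exp_neg_sq {n : ℕ} (hn : 2 ≤ n) {y γ : ℝ} (hγ : 0 ≤ γ) (hy0 : 0 ≤ y)
    (hy : y ≤ 1) (hγy : 2 * γ * (4 * n + 1) ≤ y) :
    1 ≤ 2 * Real.exp (-(y / (12 * √(n : ℝ)) - √(2 * (n : ℝ)) * γ) ^ 2) := by
  have hn2 : (2 : ℝ) ≤ n := by exact_mod_cast hn
  have hs : 1 ≤ √(n : ℝ) := Real.one_le_sqrt.2 (by linarith)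
  have hA : y / (12 * √(n : ℝ)) ≤ 1 / 2 := by
    rw [div_le_iff₀ (by positivity)]; nlinarith
  have hA0 : 0 ≤ y / (12 * √(n : ℝ)) := by positivity
  have hB0 : 0 ≤ √(2 * (n : ℝ)) * γ := by positivity
  have hB : √(2 * (n : ℝ)) * γ ≤ 1 / 2 := by
    have : √(2 * (n : ℝ)) ≤ 2 * n := by
      rw [Real.sqrt_le_left (by positivity)]; nlinarith
    calc √(2 * (n : ℝ)) * γ ≤ 2 * n * γ := by gcongr
      _ ≤ 1 / 2 := by nlinarith
  set u := y / (12 * √(n : ℝ)) - √(2 * (n : ℝ)) * γ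
  have hu : u ^ 2 ≤ 1 / 4 := by
    have : |u| ≤ 1 / 2 := abs_le.2 ⟨by linarith, by linarith⟩
    have := sq_le_sq' (abs_le.1 this).1 (abs_le.1 this).2
    linarith
  have := Real.add_one_le_exp (-u ^ 2)
  linarith

theorem one_le_mul_sqrt_add_sqrt_neg_log {n : ℕ} (hn : 2 ≤ n) {γ δ : ℝ} (hγ : 0 ≤ γ)
    (hδ0 : 0 < δ) (hδ : δ ≤ 1 / 2) :
    1 ≤ 12 * √(n : ℝ) * (√(2 * (n : ℝ)) * γ + √(-Real.log δ)) := by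
  have hn2 : (2 : ℝ) ≤ n := by exact_mod_cast hn
  have hs : 1 ≤ √(n : ℝ) := Real.one_le_sqrt.2 (by linarith)
  have hl : 1 / 2 ≤ √(-Real.log δ) := by
    refine Real.le_sqrt_of_sq_le ?_
    have := Real.log_le_sub_one_of_pos hδ0
    linarith
  have hB0 : 0 ≤ √(2 * (n : ℝ)) * γ := by positivity
  nlinarith

theorem theorem4p3
    {Ω : Type*} [MeasurableSpace Ω] (P : Measure Ω) [IsProbabilityMeasure P]
    (n : ℕ) (hn : 2 ≤ n)
    (X : Fin n → Ω → UnitAddCircle)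
    (hX_law : ∀ i, HasLaw (X i) (volume : Measure UnitAddCircle) P)
    (hX_indep : iIndepFun X P)
    (L : ℝ≥0) (hL : 0 < L)
    (f : UnitAddCircle → ℝ) (hf : LipschitzWith L f)
    (h : ℝ) (hh : 0 < h)
    (k : ℝ≥0 → ℝ≥0) (hk_meas : Measurable k)
    (hk_supp : tsupport k = {t : ℝ≥0 | (t : ℝ) ≤ 1 / h})
    (hk_pos : ∀ t : ℝ≥0, (t : ℝ) < 1 / h → 0 < k t)
    (Z : Ω → Fin n → UnitAddCircle × ℝ)
    (hZ : ∀ ω i, Z ω i = (X i ω, f (X i ω)))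
    (γ : ℝ) (hγ : γ = failBound n h) :
    (∀ ε : ℝ,
      2 * γ * max ((4 * n + 1) * (L : ℝ) ^ 2 / h ^ 2) (4 * uniformNorm f ^ 2) < ε →
      P.real {ω | ε < |cvScore k f (Z ω) - risk f (shepard k (leaveOut (Z ω) ⟨0, by omega⟩))|}
        ≤ 2 * γ + 2 * Real.exp
            (-(h ^ 2 * ε / (12 * √(n : ℝ) * (L : ℝ) ^ 2) - √(2 * (n : ℝ)) * γ) ^ 2)) ∧
    (∀ δ : ℝ, 0 < δ →
      1 - 2 * (γ + δ) <
        P.real {ω | |cvScore k f (Z ω) - risk f (shepard k (leaveOut (Z ω) ⟨0, by omega⟩))|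
          ≤ max (4 * γ * uniformNorm f ^ 2)
              (12 * √(n : ℝ) * (L : ℝ) ^ 2 / h ^ 2 *
                (√(2 * (n : ℝ)) * γ + √(-Real.log δ)))}) := by
  obtain ⟨hγ0, hbad⟩ := measure_resolution_lt_abs_cvScore_sub_risk_le hn hX_law hX_indep hf hh
    hk_supp hk_pos hZ ⟨0, by omega⟩
  rw [← hγ] at hγ0 hbad
  set D : Ω → ℝ := fun ω =>
    |cvScore k f (Z ω) - risk f (shepard k (leaveOut (Z ω) ⟨0, by omega⟩))| with hD
  have hall : ∀ ω, D ω ≤ max ((L * (1 / h)) ^ 2) (uniformNorm f ^ 2) := fun ω =>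
    abs_cvScore_sub_risk_le _ fun i x => sq_abs_shepard_sub_le hf hk_supp fun j => by
      simp [leaveOut, hZ]
  change (∀ ε : ℝ, _ → P.real {ω | ε < D ω} ≤ _) ∧ (∀ δ : ℝ, _ → _ < P.real {ω | D ω ≤ _})
  have hLpos : (0 : ℝ) < L := hL
  have hC : ((L : ℝ) * (1 / h)) ^ 2 = (L : ℝ) ^ 2 / h ^ 2 := by rw [mul_one_div, div_pow]
  rw [hC] at hall hbad
  set C : ℝ := (L : ℝ) ^ 2 / h ^ 2 with hCdef
  have hCpos : 0 < C := by positivity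
  have hF0 : 0 ≤ uniformNorm f ^ 2 := sq_nonneg _
  have hn0 : (0 : ℝ) < n := by exact_mod_cast (by omega : 0 < n)
  have hsn : 0 < √(n : ℝ) := Real.sqrt_pos.2 hn0
  constructor
  · intro ε hε
    have hε1 : 2 * γ * ((4 * n + 1) * C) < ε := lt_of_le_of_lt (by
      rw [hCdef, ← mul_div_assoc]; gcongr; exact le_max_left _ _) hε
    have hε2 : 2 * γ * (4 * uniformNorm f ^ 2) < ε := lt_of_le_of_lt (by
      gcongr; exact le_max_right _ _) hε
    rcases lt_or_ge ε C with hεC | hεC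
    · have hu : h ^ 2 * ε / (12 * √(n : ℝ) * (L : ℝ) ^ 2) = ε / C / (12 * √(n : ℝ)) := by
        rw [hCdef]; field_simp
      rw [hu]
      have hε0 : 0 ≤ ε := le_trans (by positivity) hε1.le
      have h1 := one_le_two_mul_exp_neg_sq hn (y := ε / C) hγ0 (by positivity)
        ((div_le_one hCpos).2 hεC.le) (by rw [le_div_iff₀ hCpos]; linarith)
      have h2 : P.real {ω | ε < D ω} ≤ 1 := measureReal_le_one
      linarith
    · have hexp := Real.exp_pos
        (-(h ^ 2 * ε / (12 * √(n : ℝ) * (L : ℝ) ^ 2) - √(2 * (n : ℝ)) * γ) ^ 2)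
      rcases lt_or_ge γ (1 / 4) with hγ4 | hγ4
      · have h1 : P.real {ω | ε < D ω} ≤ P.real {ω | C < D ω} :=
          measureReal_mono fun ω (hω : ε < D ω) => lt_of_le_of_lt hεC hω
        have h2 : P.real {ω | C < D ω} ≤ 2 * γ := hbad hγ4
        linarith
      · have hempty : {ω | ε < D ω} = ∅ := Set.eq_empty_of_forall_notMem fun ω hω =>
          ((hall ω).trans (max_le hεC (by nlinarith))).not_gt hω
        rw [hempty, measureReal_empty]
        positivity
  · intro δ hδ
    rcases lt_or_ge (1 / 2) (γ + δ) with hγδ | hγδ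
    · exact lt_of_lt_of_le (by linarith) measureReal_nonneg
    have h1 := one_le_mul_sqrt_add_sqrt_neg_log hn hγ0 hδ (by linarith)
    set M := max (4 * γ * uniformNorm f ^ 2)
      (12 * √(n : ℝ) * (L : ℝ) ^ 2 / h ^ 2 * (√(2 * (n : ℝ)) * γ + √(-Real.log δ))) with hM
    have hCM : C ≤ M := by
      refine le_trans ?_ (le_max_right _ _)
      rw [show 12 * √(n : ℝ) * (L : ℝ) ^ 2 / h ^ 2 * (√(2 * (n : ℝ)) * γ + √(-Real.log δ))
        = C * (12 * √(n : ℝ) * (√(2 * (n : ℝ)) * γ + √(-Real.log δ))) by rw [hCdef]; ring]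
      exact le_mul_of_one_le_right hCpos.le h1
    rcases lt_or_ge γ (1 / 4) with hγ4 | hγ4
    · have h2 : P.real {ω | C < D ω} ≤ 2 * γ := hbad hγ4
      have hcover : Set.univ ⊆ {ω | D ω ≤ M} ∪ {ω | C < D ω} := fun ω _ =>
        (le_or_gt (D ω) C).imp (fun hω => hω.trans hCM) id
      have h3 := (measureReal_mono (μ := P) hcover).trans (measureReal_union_le _ _)
      rw [probReal_univ] at h3
      linarith
    · have huniv : {ω | D ω ≤ M} = Set.univ := Set.eq_univ_of_forall fun ω =>
        (hall ω).trans (max_le hCM (le_trans (by nlinarith) (le_max_left _ _)))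
      rw [huniv, probReal_univ]
      linarith
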